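/- \textbf{Setting.} Let $\mathcal L$ be a first-order language with equality, $\mathit{Pred}_u\subseteq\mathcal L$ a set of predicate symbols (the user-defined predicates), and $\mathcal C$ a set of formulas of $\mathcal L\setminus \mathit{Pred}_u$, called constraints, that contains $\mathit{true}$, $\mathit{false}$ and all equalities between terms and is closed under conjunction; let $\mathcal A\subseteq\mathcal C$. Fix an interpretation $\mathbb D$, with a non-empty universe, of the symbols of $\mathcal L\setminus \mathit{Pred}_u$. An atom is a formula $p(X_1,\dots,X_m)$ with $p\in \mathit{Pred}_u$ and $X_1,\dots,X_m$ distinct variables. A constrained Horn clause is an implication $H\leftarrow c,G$, where $c\in\mathcal C$, $G$ is a finite (possibly empty) conjunction of atoms, and $H$ is an atom or $\mathit{false}$; conjunctions of atoms are read up to reordering, and a clause with a term $t$ as an argument of a body atom, $H\leftarrow c,G_1,p(\dots,t,\dots),G_2$, is a shorthand for $H\leftarrow Z=t,\,c,G_1,p(\dots,Z,\dots),G_2$ with $Z$ a variable not occurring elsewhere in the clause. A set $P$ of clauses is $\mathbb D$-satisfiable if the universal closures of its clauses are all true in some interpretation of $\mathcal L$ that agrees with $\mathbb D$ on $\mathcal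 L\setminus \mathit{Pred}_u$. We write $\mathit{vars}$ and $\mathit{Fvars}$ for the sets of variables and of free variables. A \emph{transformation sequence} is a sequence $P_0,\dots,P_n$ of sets of clauses with constraints in $\mathcal C$, together with sets $\mathit{Defs}_0=\emptyset,\mathit{Defs}_1,\dots,\mathit{Defs}_n$ of clauses called definitions, where for $0\le i<n$ the set $P_{i+1}$ is obtained from $P_i$ by one of the following rules, and $\mathit{Defs}_{i+1}=\mathit{Defs}_i$ except for the first rule. \begin{itemize} \item \emph{Definition.} $P_{i+1}=P_i\cup\{D\}$ and $\mathit{Defs}_{i+1}=\mathit{Defs}_i\cup\{D\}$, where $D$ is a clause $\mathit{newp}(X_1,\dots,X_k)\leftarrow c,G$ such that the predicate $\mathit{newp}$ does not occur in $P_0,\dots,P_i$, $c\in\mathcal A$, $G$ is a non-empty conjunction of atoms whose predicates occur in $P_0$, and $X_1,\dots,X_k$ are distinct variables occurring free in $(c,G)$. \item \emph{Unfolding} (of an atom $A=p(X_1,\dots,X_k)$ in a clause $C$). Let $C\in P_i$ be $H\leftarrow c,G_1,A,G_2$. Take the clauses of $P_i$ whose head predicate is $p$, renamed to clauses $A\leftarrow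 c_j,B_j$ ($j\in J$) with $\mathit{vars}(c_j,B_j)\cap \mathit{vars}(C)\subseteq\{X_1,\dots,X_k\}$. Then $P_{i+1}=(P_i\setminus\{C\})\cup\{H\leftarrow c, c_j,G_1,B_j,G_2\mid j\in J\}$. \item \emph{Folding.} Let $C\in P_i$ be $H\leftarrow c,G_1,Q,G_2$ with $Q$ a non-empty conjunction of atoms, and let $D$: $K\leftarrow d,B$ be a variant of a clause of $\mathit{Defs}_i$ that has no variable in common with $C$. Suppose that there are a substitution $\vartheta$ and a constraint $e$ such that (i) $Q=B\vartheta$; (ii) $\mathbb D\models\forall(c\leftrightarrow(e\wedge d\vartheta))$; (iii) for every variable $X\in \mathit{vars}(d,B)\setminus \mathit{vars}(K)$, $X\vartheta$ is a variable that does not occur in $\{H,e,G_1,G_2\}$ and that does not occur in $Y\vartheta$ for any variable $Y$ of $(d,B)$ different from $X$. Then $P_{i+1}=(P_i\setminus\{C\})\cup\{H\leftarrow e,G_1,K\vartheta,G_2\}$. \item \emph{Constraint replacement.} Let $(H\leftarrow c_1,G),\dots,(H\leftarrow c_k,G)$ be clauses of $P_i$ and let $d_1,\dots,d_m$ ($m\ge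 0$) be constraints with $$\mathbb D\models\forall\bigl(\exists Y_1\dots\exists Y_r\,(c_1\vee\dots\vee c_k)\leftrightarrow\exists Z_1\dots\exists Z_s\,(d_1\vee\dots\vee d_m)\bigr),$$ where $\{Y_1,\dots,Y_r\}=\mathit{Fvars}(c_1\vee\dots\vee c_k)\setminus \mathit{vars}(\{H,G\})$ and $\{Z_1,\dots,Z_s\}=\mathit{Fvars}(d_1\vee\dots\vee d_m)\setminus \mathit{vars}(\{H,G\})$. Then $P_{i+1}=(P_i\setminus\{(H\leftarrow c_1,G),\dots,(H\leftarrow c_k,G)\})\cup\{(H\leftarrow d_1,G),\dots,(H\leftarrow d_m,G)\}$. \end{itemize} \textbf{Theorem (Equivalence with respect to $\mathbb D$-satisfiability).} Let $P_0,\dots,P_n$ be a transformation sequence such that every definition is unfolded during its construction, that is, for every $D\in \mathit{Defs}_n$ there is an $i$ with $0\le i\le n-1$ such that $P_{i+1}$ is derived from $P_i$ by unfolding an atom in $D$. Then $P_0$ is $\mathbb D$-satisfiable if and only if $P_n$ is $\mathbb D$-satisfiable. -/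

import Mathlib

universe u v w x

namespace CHC

/-! Constrained Horn clauses.  `L` is the first-order language (with equality) of the constraints,
`Pred` is the set of user-defined predicate symbols, `ar p` is the arity of `p`, and the variables
are the natural numbers. -/

/-- An atom `p(X₁,…,Xₘ)`, where `X₁,…,Xₘ` are distinct variables. -/
structure Atom {Pred : Type x} (ar : Pred → ℕ) where
  pred : Pred
  args : Fin (ar pred) ↪ ℕ

/-- A constrained Horn clause `H ← c, A₁,…,Aₙ`.  The head `none` stands for `false`: then the
clause is a constrained goal. -/
structure Clause (L : FirstOrder.Language.{u, v}) {Pred : Type x} (ar : Pred → ℕ) where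
  head : Option (Atom ar)
  constr : L.Formula ℕ
  body : List (Atom ar)

/-- An atom `p(t₁,…,tₘ)` whose arguments are arbitrary terms. -/
structure TermAtom (L : FirstOrder.Language.{u, v}) {Pred : Type x} (ar : Pred → ℕ) where
  pred : Pred
  args : Fin (ar pred) → L.Term ℕ

/-- A clause in which terms are allowed as arguments of the atoms of the body; it is a shorthand
for a clause in the strict sense, see `TermClause.IsShorthandFor`. -/
structure TermClause (L : FirstOrder.Language.{u, v}) {Pred : Type x} (ar : Pred → ℕ) where
  head : Option (Atom ar)
  constr : L.Formula ℕ
  body : List (TermAtom L ar)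

/-- A set of formulas that may serve as the set of constraints: it contains *true*, *false* and
the equalities between terms, and it is closed under conjunction. -/
structure IsConstraintSet {L : FirstOrder.Language.{u, v}} (𝒞 : Set (L.Formula ℕ)) : Prop where
  top_mem : (⊤ : L.Formula ℕ) ∈ 𝒞
  bot_mem : (⊥ : L.Formula ℕ) ∈ 𝒞
  equal_mem : ∀ s t : L.Term ℕ, s.equal t ∈ 𝒞
  inf_mem : ∀ c ∈ 𝒞, ∀ d ∈ 𝒞, c ⊓ d ∈ 𝒞

section Syntax_notions

variable {L : FirstOrder.Language.{u, v}} {Pred : Type x} {ar : Pred → ℕ}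

/-! ### Variables, predicates, renaming, substitution -/

def termVars (t : L.Term ℕ) : Set ℕ := ↑t.varFinset

/-- The variables of a constraint (bound variables are nameless here). -/
def formulaVars (c : L.Formula ℕ) : Set ℕ :=
  ↑(FirstOrder.Language.BoundedFormula.freeVarFinset c)

def Atom.vars (A : Atom ar) : Set ℕ := Set.range A.args

def TermAtom.vars (T : TermAtom L ar) : Set ℕ := ⋃ i, termVars (T.args i)

/-- The variables of a clause head; `false` has none. -/
def headVars (H : Option (Atom ar)) : Set ℕ := {y | ∃ A ∈ H, y ∈ A.vars}

/-- The variables of a conjunction of atoms. -/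
def bodyVars (G : List (Atom ar)) : Set ℕ := {y | ∃ A ∈ G, y ∈ A.vars}

def termBodyVars (G : List (TermAtom L ar)) : Set ℕ := {y | ∃ T ∈ G, y ∈ T.vars}

def Clause.vars (C : Clause L ar) : Set ℕ :=
  headVars C.head ∪ formulaVars C.constr ∪ bodyVars C.body

def TermClause.vars (C : TermClause L ar) : Set ℕ :=
  headVars C.head ∪ formulaVars C.constr ∪ termBodyVars C.body

/-- The predicate `p` is the predicate of the head of the clause. -/
def Clause.HeadPred (C : Clause L ar) (p : Pred) : Prop := ∃ A ∈ C.head, A.pred = p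

/-- The predicate `p` occurs in a clause of `P`. -/
def Occurs (p : Pred) (P : Set (Clause L ar)) : Prop :=
  ∃ C ∈ P, C.HeadPred p ∨ ∃ A ∈ C.body, A.pred = p

def Atom.rename (ρ : Equiv.Perm ℕ) (A : Atom ar) : Atom ar :=
  ⟨A.pred, A.args.trans ρ.toEmbedding⟩

/-- The variant of a clause obtained by the renaming `ρ` of the variables. -/
def Clause.rename (ρ : Equiv.Perm ℕ) (C : Clause L ar) : Clause L ar :=
  ⟨C.head.map (Atom.rename ρ), C.constr.relabel ρ, C.body.map (Atom.rename ρ)⟩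

/-- The instance `Aϑ` of an atom. -/
def Atom.subst (ϑ : ℕ → L.Term ℕ) (A : Atom ar) : TermAtom L ar :=
  ⟨A.pred, fun i => ϑ (A.args i)⟩

def Atom.toTermAtom (A : Atom ar) : TermAtom L ar :=
  ⟨A.pred, fun i => FirstOrder.Language.Term.var (A.args i)⟩

def Clause.toTermClause (C : Clause L ar) : TermClause L ar :=
  ⟨C.head, C.constr, C.body.map Atom.toTermAtom⟩

/-- `H ← c, G₁, p(…,t,…), G₂` becomes `H ← Z = t, c, G₁, p(…,Z,…), G₂`, where `Z` is a variable
not occurring elsewhere in the clause. -/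
def TermClause.ExpandStep (X X' : TermClause L ar) : Prop :=
  ∃ (G₁ G₂ : List (TermAtom L ar)) (T : TermAtom L ar) (i : Fin (ar T.pred)) (Z : ℕ),
    X.body = G₁ ++ T :: G₂ ∧ Z ∉ X.vars ∧
    X' = ⟨X.head, (FirstOrder.Language.Term.var Z).equal (T.args i) ⊓ X.constr,
      G₁ ++ ⟨T.pred, Function.update T.args i (FirstOrder.Language.Term.var Z)⟩ :: G₂⟩

/-- The clause `X`, which may have terms as arguments of the atoms of its body, is a shorthand for
the clause `C`.  (If all arguments in each atom of `X` are distinct variables, `C` may be `X`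
itself.) -/
def TermClause.IsShorthandFor (X : TermClause L ar) (C : Clause L ar) : Prop :=
  Relation.ReflTransGen TermClause.ExpandStep X C.toTermClause

end Syntax_notions

section Semantics_notions

/-! ### Semantics.  The canonical interpretation `𝔻` is the `L`-structure on the universe `U`. -/

/-- A `𝔻`-interpretation, given by the relations that interpret the user-defined predicates. -/
abbrev Interp {Pred : Type x} (ar : Pred → ℕ) (U : Type w) :=
  (p : Pred) → (Fin (ar p) → U) → Prop

variable {L : FirstOrder.Language.{u, v}} {Pred : Type x} {ar : Pred → ℕ} {U : Type w}

def Atom.Holds (I : Interp ar U) (s : ℕ → U) (A : Atom ar) : Prop :=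
  I A.pred (fun i => s (A.args i))

/-- The head of a clause holds; `false` never does. -/
def HeadHolds (I : Interp ar U) (s : ℕ → U) (H : Option (Atom ar)) : Prop :=
  ∃ A ∈ H, A.Holds I s

/-- The universal closure of the clause is true in the `𝔻`-interpretation `I`. -/
def Clause.IsTrue [L.Structure U] (I : Interp ar U) (C : Clause L ar) : Prop :=
  ∀ s : ℕ → U, C.constr.Realize s → (∀ A ∈ C.body, A.Holds I s) → HeadHolds I s C.head

/-- `P` is `𝔻`-satisfiable: it has a `𝔻`-model. -/
def DSatisfiable (U : Type w) [L.Structure U] (P : Set (Clause L ar)) : Prop :=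
  ∃ I : Interp ar U, ∀ C ∈ P, C.IsTrue I

/-- `∃ Y₁ … ∃ Yᵣ (c₁ ∨ … ∨ cₖ)` is true under the assignment `s`, where `{Y₁,…,Yᵣ}` is the set of
the free variables of `c₁ ∨ … ∨ cₖ` that are not in `W`. -/
def ExistsDisj [L.Structure U] (W : Set ℕ) (cs : List (L.Formula ℕ)) (s : ℕ → U) : Prop :=
  ∃ s' : ℕ → U, (∀ y, ¬ ((∃ c ∈ cs, y ∈ formulaVars c) ∧ y ∉ W) → s' y = s y) ∧
    ∃ c ∈ cs, c.Realize s'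

end Semantics_notions

section Rules

variable {L : FirstOrder.Language.{u, v}} {Pred : Type x} {ar : Pred → ℕ}

/-! ### The transformation rules.  Conjunctions of atoms are read up to reordering. -/

/-- Definition rule: `D` may be introduced after the sets `P 0, …, P i`. -/
def IsNewDefinition (𝒜 : Set (L.Formula ℕ)) (P : ℕ → Set (Clause L ar)) (i : ℕ)
    (D : Clause L ar) : Prop :=
  ∃ K : Atom ar, D.head = some K ∧
    (∀ j ≤ i, ¬ Occurs K.pred (P j)) ∧
    D.constr ∈ 𝒜 ∧
    D.body ≠ [] ∧ (∀ A ∈ D.body, Occurs A.pred (P 0)) ∧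
    K.vars ⊆ formulaVars D.constr ∪ bodyVars D.body

/-- `R` is the clause `H ← c, c', B', G`, where the clause unfolded is `C`: `H ← c, A, G`, the atom
unfolded is `A`, and `A ← c', B'` is a variant of `E` that shares with `C` variables of `A`
only. -/
def IsResolvent (C : Clause L ar) (A : Atom ar) (G : List (Atom ar)) (E R : Clause L ar) : Prop :=
  ∃ ρ : Equiv.Perm ℕ,
    (E.rename ρ).head = some A ∧
    (formulaVars (E.rename ρ).constr ∪ bodyVars (E.rename ρ).body) ∩ C.vars ⊆ A.vars ∧
    R.head = C.head ∧
    R.constr = C.constr ⊓ (E.rename ρ).constr ∧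
    R.body.Perm ((E.rename ρ).body ++ G)

/-- Unfolding rule: `P'` is derived from `P` by unfolding some atom `A` in the clause `C` of `P`
using `P`. -/
def IsUnfolding (P : Set (Clause L ar)) (C : Clause L ar) (P' : Set (Clause L ar)) : Prop :=
  C ∈ P ∧ ∃ (A : Atom ar) (G : List (Atom ar)) (R : Clause L ar → Clause L ar),
    C.body.Perm (A :: G) ∧
    (∀ E ∈ P, E.HeadPred A.pred → IsResolvent C A G E (R E)) ∧
    P' = (P \ {C}) ∪ R '' {E | E ∈ P ∧ E.HeadPred A.pred}

/-- Folding rule: `P'` is derived from `P` by folding a clause `C`: `H ← c, Bϑ, G` of `P` using a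
variant `D`: `K ← d, B` of a clause in `Defs`, which gives the clause `E`: `H ← e, Kϑ, G`. -/
def IsFolding (U : Type w) [L.Structure U] (𝒞 : Set (L.Formula ℕ)) (Defs P : Set (Clause L ar))
    (P' : Set (Clause L ar)) : Prop :=
  ∃ C ∈ P, ∃ D₀ ∈ Defs, ∃ (ρ : Equiv.Perm ℕ) (D : Clause L ar) (K : Atom ar)
    (ϑ : ℕ → L.Term ℕ) (e : L.Formula ℕ) (X Y : TermClause L ar) (G : List (TermAtom L ar))
    (E : Clause L ar),
    D = D₀.rename ρ ∧ D.head = some K ∧ Disjoint C.vars D.vars ∧ e ∈ 𝒞 ∧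
    -- the clause that is folded, with the conjunction `Bϑ` in its body
    X.IsShorthandFor C ∧ X.body.Perm (D.body.map (Atom.subst ϑ) ++ G) ∧
    -- `c ↔ e ∧ dϑ` is valid in `𝔻`
    (∀ s : ℕ → U, X.constr.Realize s ↔
      e.Realize s ∧ FirstOrder.Language.Formula.Realize (FirstOrder.Language.BoundedFormula.subst D.constr ϑ) s) ∧
    -- the variables of the body of `D` that are not in its head
    (∀ y ∈ (formulaVars D.constr ∪ bodyVars D.body) \ K.vars,
      (∃ z : ℕ, ϑ y = FirstOrder.Language.Term.var z ∧
        z ∉ headVars X.head ∪ formulaVars e ∪ termBodyVars G ∧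
        ∀ y' ∈ formulaVars D.constr ∪ bodyVars D.body, y' ≠ y → z ∉ termVars (ϑ y'))) ∧
    -- the clause that is derived
    Y.head = X.head ∧ Y.constr = e ∧ Y.body.Perm (K.subst ϑ :: G) ∧ Y.IsShorthandFor E ∧
    P' = (P \ {C}) ∪ {E}

/-- Constraint replacement rule: the clauses `H ← c, G` of `P` with `c` in `cs` are replaced by the
clauses `H ← d, G` with `d` in `ds`. -/
def IsConstraintReplacement (U : Type w) [L.Structure U] (P P' : Set (Clause L ar)) : Prop :=
  ∃ (H : Option (Atom ar)) (G : List (Atom ar)) (cs ds : List (L.Formula ℕ)),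
    {C | ∃ c ∈ cs, C = ⟨H, c, G⟩} ⊆ P ∧
    (∀ s : ℕ → U, ExistsDisj (headVars H ∪ bodyVars G) cs s ↔
      ExistsDisj (headVars H ∪ bodyVars G) ds s) ∧
    P' = (P \ {C | ∃ c ∈ cs, C = ⟨H, c, G⟩}) ∪ {C | ∃ d ∈ ds, C = ⟨H, d, G⟩}

/-- `P 0, …, P n` is a transformation sequence over `𝒞`, and `Defs i` is the set of the definitions
introduced during the construction of `P 0, …, P i`. -/
structure IsTransformationSequence (U : Type w) [L.Structure U] (𝒞 𝒜 : Set (L.Formula ℕ)) (n : ℕ)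
    (P Defs : ℕ → Set (Clause L ar)) : Prop where
  constr_mem : ∀ i ≤ n, ∀ C ∈ P i, C.constr ∈ 𝒞
  defs_zero : Defs 0 = ∅
  step : ∀ i < n,
    (∃ D, IsNewDefinition 𝒜 P i D ∧ P (i + 1) = P i ∪ {D} ∧ Defs (i + 1) = Defs i ∪ {D}) ∨
    (Defs (i + 1) = Defs i ∧
      ((∃ C, IsUnfolding (P i) C (P (i + 1))) ∨
        IsFolding U 𝒞 (Defs i) (P i) (P (i + 1)) ∨
        IsConstraintReplacement U (P i) (P (i + 1))))

end Rules

end CHC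

/-!
Only the ground instances of the clauses matter: each rule acts on them in a simple way, and they
do not change under renamings and under the expansion of shorthands.

A model of `P 0` extends to the new predicates by reading each definition as an equivalence.  The
extension is well defined because the head predicates of the definitions do not occur in `P 0`,
while the predicates of their bodies do, and because different definitions have different head
predicates.  Each rule derives clauses that are true in the extension; folding uses the converse
direction of the equivalence (`IsTransformationSequence.groundTrue_extension`).

For the converse, give each ground atom the weight of its lightest proof from `P 0` and all the
definitions, where using a clause of `P 0` weighs one and using a definition weighs nothing.  The
proof shows that the atoms of finite weight form a model of `P 0`, as soon as `P n` has a model.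
A head is *covered* by `P i` within the weight `b` if it is the head of a ground instance of `P i`
with a body of weight at most `b`.  No step loses coverage
(`IsTransformationSequence.covers_succ`): unfolding replaces an atom by a body that covers it,
folding replaces the body of a definition by its head, which weighs no more, and constraint
replacement keeps the ground instances.  Coverage within a weight smaller than that of the head
holds for the predicates of `P 0` from the start.  For the head of a definition it holds as soon as
the definition has been unfolded, since the atom unfolded is one with a predicate of `P 0`; this is
where the hypothesis on the definitions enters
(`IsTransformationSequence.strictlyCovers_last`).  Hence, by induction on the weight, the atoms of
finite weight are true in every model of `P n` (`holds_of_strictlyCovers`).  If they violated a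
goal of `P 0`, then `false` would be covered within a finite weight in `P 0` and thus in `P n`, so
that `P n` would have no model.
-/

namespace CHC

open FirstOrder.Language

/-! ### Ground instances -/

section Ground

variable {L : FirstOrder.Language.{u, v}} {Pred : Type x} {ar : Pred → ℕ} {U : Type w}

/-- A ground atom: a user-defined predicate applied to elements of the universe. -/
abbrev GroundAtom {Pred : Type x} (ar : Pred → ℕ) (U : Type w) := (p : Pred) × (Fin (ar p) → U)

/-- A ground clause: a head (`none` stands for `false`) and a body.  Bodies are multisets because
conjunctions are read up to reordering. -/
abbrev GroundClause {Pred : Type x} (ar : Pred → ℕ) (U : Type w) :=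
  Option (GroundAtom ar U) × Multiset (GroundAtom ar U)

/-- The instance of an atom under an assignment. -/
def Atom.ground (s : ℕ → U) (A : Atom ar) : GroundAtom ar U := ⟨A.pred, fun i => s (A.args i)⟩

/-- The ground instances of a clause, one for each assignment that satisfies its constraint. -/
def Clause.ground (U : Type w) [L.Structure U] (C : Clause L ar) : Set (GroundClause ar U) :=
  {q | ∃ s : ℕ → U, C.constr.Realize s ∧
    q = (C.head.map (Atom.ground s), ↑(C.body.map (Atom.ground s)))}

/-- The instance of an atom with term arguments under an assignment. -/
def TermAtom.ground [L.Structure U] (s : ℕ → U) (T : TermAtom L ar) : GroundAtom ar U :=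
  ⟨T.pred, fun i => (T.args i).realize s⟩

/-- The ground instances of a clause with term arguments. -/
def TermClause.ground (U : Type w) [L.Structure U] (X : TermClause L ar) :
    Set (GroundClause ar U) :=
  {q | ∃ s : ℕ → U, X.constr.Realize s ∧
    q = (X.head.map (Atom.ground s), ↑(X.body.map (TermAtom.ground s)))}

/-- The ground instances of the clauses of `P`. -/
def groundings (U : Type w) [L.Structure U] (P : Set (Clause L ar)) : Set (GroundClause ar U) :=
  {q | ∃ C ∈ P, q ∈ C.ground U}

theorem groundings_mono [L.Structure U] {P Q : Set (Clause L ar)} (h : P ⊆ Q) :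
    groundings U P ⊆ groundings U Q := fun _ ⟨C, hC, hq⟩ => ⟨C, h hC, hq⟩

/-- A ground clause is true if its head is a true atom or some atom of its body is false. -/
def GroundTrue (I : Interp ar U) (q : GroundClause ar U) : Prop :=
  (∀ g ∈ q.2, I g.1 g.2) → ∃ g ∈ q.1, I g.1 g.2

theorem Clause.isTrue_iff_ground [L.Structure U] {I : Interp ar U} {C : Clause L ar} :
    C.IsTrue I ↔ ∀ q ∈ C.ground U, GroundTrue I q := by
  constructor
  · rintro h _ ⟨s, hs, rfl⟩ hB
    obtain ⟨A, hA, hI⟩ := h s hs fun A hA => hB (A.ground s)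
      (Multiset.mem_coe.2 (List.mem_map_of_mem hA))
    exact ⟨A.ground s, Option.mem_map_of_mem _ hA, hI⟩
  · intro h s hs hB
    obtain ⟨g, hg, hI⟩ := h _ ⟨s, hs, rfl⟩ (by
      intro g hg
      obtain ⟨A, hA, rfl⟩ := List.mem_map.1 (Multiset.mem_coe.1 hg)
      exact hB A hA)
    obtain ⟨A, hA, rfl⟩ := Option.mem_map.1 hg
    exact ⟨A, hA, hI⟩

theorem forall_isTrue_iff [L.Structure U] {I : Interp ar U} {P : Set (Clause L ar)} :
    (∀ C ∈ P, C.IsTrue I) ↔ ∀ q ∈ groundings U P, GroundTrue I q :=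
  ⟨fun h _ ⟨C, hC, hq⟩ => Clause.isTrue_iff_ground.1 (h C hC) _ hq,
    fun h C hC => Clause.isTrue_iff_ground.2 fun q hq => h q ⟨C, hC, hq⟩⟩

theorem headPred_of_mem_ground [L.Structure U] {C : Clause L ar} {g : GroundAtom ar U}
    {B : Multiset (GroundAtom ar U)} (h : (some g, B) ∈ C.ground U) : C.HeadPred g.1 := by
  obtain ⟨s, -, hq⟩ := h
  obtain ⟨K, hK, rfl⟩ := Option.map_eq_some_iff.1 (Prod.ext_iff.1 hq).1.symm
  exact ⟨K, hK, rfl⟩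

theorem exists_body_pred_of_mem_ground [L.Structure U] {C : Clause L ar}
    {q : GroundClause ar U} (h : q ∈ C.ground U) {g : GroundAtom ar U} (hg : g ∈ q.2) :
    ∃ A ∈ C.body, A.pred = g.1 := by
  obtain ⟨s, -, rfl⟩ := h
  obtain ⟨A, hA, rfl⟩ := List.mem_map.1 (Multiset.mem_coe.1 hg)
  exact ⟨A, hA, rfl⟩

/-! ### Dependence on the assignment -/

theorem Atom.ground_congr {s s' : ℕ → U} {A : Atom ar} (h : ∀ y ∈ A.vars, s y = s' y) :
    A.ground s = A.ground s' := by
  unfold Atom.ground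
  congr 1
  funext i
  exact h _ ⟨i, rfl⟩

theorem head_ground_congr {s s' : ℕ → U} {H : Option (Atom ar)}
    (h : ∀ y ∈ headVars H, s y = s' y) :
    H.map (Atom.ground s) = H.map (Atom.ground s') :=
  Option.map_congr fun A hA => Atom.ground_congr fun y hy => h y ⟨A, hA, hy⟩

theorem body_ground_congr {s s' : ℕ → U} {G : List (Atom ar)}
    (h : ∀ y ∈ bodyVars G, s y = s' y) :
    G.map (Atom.ground s) = G.map (Atom.ground s') :=
  List.map_congr_left fun A hA => Atom.ground_congr fun y hy => h y ⟨A, hA, hy⟩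

theorem term_realize_congr [L.Structure U] {s s' : ℕ → U} {t : L.Term ℕ}
    (h : ∀ y ∈ termVars t, s y = s' y) : t.realize s = t.realize s' := by
  induction t with
  | var z => exact h z (by simp [termVars, Term.varFinset])
  | func f ts ih =>
    simp only [Term.realize]
    congr 1
    funext i
    refine ih i fun y hy => h y ?_
    simp only [termVars, Term.varFinset, Finset.coe_biUnion, Set.mem_iUnion]
    exact ⟨i, by simp, hy⟩

theorem realize_congr [L.Structure U] {s s' : ℕ → U} {c : L.Formula ℕ}
    (h : ∀ y ∈ formulaVars c, s y = s' y) : c.Realize s ↔ c.Realize s' := by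
  have key : ∀ t : ℕ → U, (BoundedFormula.restrictFreeVar c id).Realize
      (fun y => t y.1) (default : Fin 0 → U) ↔ c.Realize t := fun t =>
    BoundedFormula.realize_restrictFreeVar t fun _ => rfl
  rw [← key s, ← key s']
  have : (fun y : BoundedFormula.freeVarFinset c => s y.1) = fun y => s' y.1 :=
    funext fun y => h y.1 y.2
  exact iff_of_eq (congrArg (fun t => (BoundedFormula.restrictFreeVar c id).Realize t default) this)

theorem TermAtom.ground_congr [L.Structure U] {s s' : ℕ → U} {T : TermAtom L ar}
    (h : ∀ y ∈ T.vars, s y = s' y) : T.ground s = T.ground s' := by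
  unfold TermAtom.ground
  congr 1
  funext i
  exact term_realize_congr fun y hy => h y (Set.mem_iUnion.2 ⟨i, hy⟩)

theorem termBody_ground_congr [L.Structure U] {s s' : ℕ → U} {G : List (TermAtom L ar)}
    (h : ∀ y ∈ termBodyVars G, s y = s' y) :
    G.map (TermAtom.ground s) = G.map (TermAtom.ground s') :=
  List.map_congr_left fun T hT => TermAtom.ground_congr fun y hy => h y ⟨T, hT, hy⟩

/-! ### Renamings and shorthands do not change the ground instances -/

theorem Clause.instance_rename [L.Structure U] (ρ : Equiv.Perm ℕ) (C : Clause L ar)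
    (s : ℕ → U) :
    ((C.rename ρ).constr.Realize s ↔ C.constr.Realize (s ∘ ρ)) ∧
    (C.rename ρ).head.map (Atom.ground s) = C.head.map (Atom.ground (s ∘ ρ)) ∧
    (C.rename ρ).body.map (Atom.ground s) = C.body.map (Atom.ground (s ∘ ρ)) := by
  refine ⟨Formula.realize_relabel, ?_, ?_⟩
  · simp only [Clause.rename, Option.map_map]; rfl
  · simp only [Clause.rename, List.map_map]; rfl

theorem Clause.ground_rename [L.Structure U] (ρ : Equiv.Perm ℕ) (C : Clause L ar) :
    (C.rename ρ).ground U = C.ground U := by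
  ext q
  constructor
  · rintro ⟨s, hs, rfl⟩
    obtain ⟨h1, h2, h3⟩ := C.instance_rename ρ s
    exact ⟨s ∘ ρ, h1.1 hs, by rw [h2, h3]⟩
  · rintro ⟨s, hs, rfl⟩
    obtain ⟨h1, h2, h3⟩ := C.instance_rename ρ (s ∘ ρ.symm)
    have hρ : (s ∘ ρ.symm) ∘ ρ = s := by funext y; simp
    rw [hρ] at h1 h2 h3
    exact ⟨s ∘ ρ.symm, h1.2 hs, by rw [h2, h3]⟩

theorem Clause.ground_toTermClause [L.Structure U] (C : Clause L ar) :
    C.toTermClause.ground U = C.ground U := by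
  simp only [TermClause.ground, Clause.ground, Clause.toTermClause, List.map_map]
  rfl

/-- The value of the fresh variable is determined by the added equation, and every value is
possible for it because it occurs nowhere else. -/
theorem TermClause.ExpandStep.ground_eq [L.Structure U] {X X' : TermClause L ar}
    (h : X.ExpandStep X') : X'.ground U = X.ground U := by
  obtain ⟨G₁, G₂, T, i, Z, hX, hZ, rfl⟩ := h
  have upd : ∀ s : ℕ → U, s Z = (T.args i).realize s →
      TermAtom.ground s (⟨T.pred, Function.update T.args i (Term.var Z)⟩ : TermAtom L ar) =
        T.ground s := by
    intro s hs
    unfold TermAtom.ground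
    congr 1
    funext j
    rcases eq_or_ne j i with hj | hj
    · rw [hj]; simpa using hs
    · simp [Function.update_of_ne hj]
  ext q
  constructor
  · rintro ⟨s, hs, rfl⟩
    obtain ⟨h1, h2⟩ := Formula.realize_inf.1 hs
    have h1 : s Z = (T.args i).realize s := by simpa [Formula.realize_equal] using h1
    refine ⟨s, h2, ?_⟩
    simp only [hX, List.map_append, List.map_cons, upd s h1]
  · rintro ⟨s, hs, rfl⟩
    set s' : ℕ → U := Function.update s Z ((T.args i).realize s) with hs'
    have hag : ∀ y ∈ X.vars, s' y = s y := by
      intro y hy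
      exact Function.update_of_ne (ne_of_mem_of_not_mem hy hZ) _ _
    have hTi : (T.args i).realize s' = (T.args i).realize s :=
      term_realize_congr fun y hy => hag y (Or.inr
        ⟨T, by simp [hX], Set.mem_iUnion.2 ⟨i, hy⟩⟩)
    have h1 : s' Z = (T.args i).realize s' := by rw [hTi]; simp [hs']
    have hb := termBody_ground_congr (U := U) (s := s') (s' := s) (G := X.body)
      fun y hy => hag y (Or.inr hy)
    have hh := head_ground_congr (s := s') (s' := s) (H := X.head)
      fun y hy => hag y (Or.inl (Or.inl hy))
    refine ⟨s', Formula.realize_inf.2 ⟨by simpa [Formula.realize_equal] using h1, ?_⟩, ?_⟩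
    · exact (realize_congr fun y hy => hag y (Or.inl (Or.inr hy))).2 hs
    · rw [← hb, ← hh]
      simp only [hX, List.map_append, List.map_cons, upd s' h1]

theorem TermClause.IsShorthandFor.ground_eq [L.Structure U] {X : TermClause L ar}
    {C : Clause L ar} (h : X.IsShorthandFor C) : X.ground U = C.ground U := by
  rw [← C.ground_toTermClause]
  unfold TermClause.IsShorthandFor at h
  generalize C.toTermClause = X' at h
  induction h with
  | refl => rfl
  | tail _ h ih => rw [ih, h.ground_eq]

/-! ### The rules on ground instances -/

/-- The ground instances of a resolvent are the ground resolvents.  The condition on the variables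
allows an instance of `C` and one of `E` that agree on `A` to be given by one assignment. -/
theorem IsResolvent.ground_eq [L.Structure U] {C E R : Clause L ar} {A : Atom ar}
    {G : List (Atom ar)} (hR : IsResolvent C A G E R) (hC : C.body.Perm (A :: G)) :
    R.ground U = {q | ∃ (s : ℕ → U) (B : Multiset (GroundAtom ar U)), C.constr.Realize s ∧
      (some (A.ground s), B) ∈ E.ground U ∧
      q = (C.head.map (Atom.ground s), B + ↑(G.map (Atom.ground s)))} := by
  classical
  obtain ⟨ρ, hA, hvars, hh, hc, hb⟩ := hR
  rw [← E.ground_rename ρ]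
  generalize E.rename ρ = E' at *
  have hAC : A.vars ⊆ C.vars := fun y hy => Or.inr ⟨A, hC.mem_iff.2 (by simp), hy⟩
  have hGC : bodyVars G ⊆ C.vars := by
    rintro y ⟨A', hA', hy⟩
    exact Or.inr ⟨A', hC.mem_iff.2 (by simp [hA']), hy⟩
  ext q
  constructor
  · rintro ⟨s, hs, rfl⟩
    rw [hc] at hs
    obtain ⟨h1, h2⟩ := Formula.realize_inf.1 hs
    refine ⟨s, _, h1, ⟨s, h2, by rw [hA]; rfl⟩, ?_⟩
    rw [hh, Multiset.coe_eq_coe.2 (hb.map (Atom.ground s)), List.map_append, Multiset.coe_add]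
  · rintro ⟨s, B, hs, ⟨s₂, hs₂, hq⟩, rfl⟩
    rw [hA] at hq
    obtain ⟨hq1, rfl⟩ := Prod.ext_iff.1 hq
    have hq1 : A.ground s = A.ground s₂ := Option.some_injective _ hq1
    have hAs : ∀ y ∈ A.vars, s y = s₂ y := by
      rintro _ ⟨i, rfl⟩
      exact congrFun (eq_of_heq (Sigma.mk.inj hq1).2) i
    let s' : ℕ → U := fun y => if y ∈ C.vars then s y else s₂ y
    have hC' : ∀ y ∈ C.vars, s' y = s y := fun y hy => if_pos hy
    have hE' : ∀ y ∈ formulaVars E'.constr ∪ bodyVars E'.body, s' y = s₂ y := by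
      intro y hy
      by_cases h : y ∈ C.vars
      · rw [hC' y h, hAs y (hvars ⟨hy, h⟩)]
      · exact if_neg h
    refine ⟨s', ?_, ?_⟩
    · rw [hc]
      exact Formula.realize_inf.2
        ⟨(realize_congr fun y hy => hC' y (Or.inl (Or.inr hy))).2 hs,
          (realize_congr fun y hy => hE' y (Or.inl hy)).2 hs₂⟩
    · rw [hh, Multiset.coe_eq_coe.2 (hb.map (Atom.ground s')), List.map_append,
        body_ground_congr (G := G) (fun y hy => hC' y (hGC hy)),
        body_ground_congr (G := E'.body) (fun y hy => hE' y (Or.inr hy)),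
        head_ground_congr (H := C.head) (fun y hy => hC' y (Or.inl (Or.inl hy))),
        Multiset.coe_add]

theorem IsUnfolding.mem_groundings [L.Structure U] {P P' : Set (Clause L ar)} {C : Clause L ar}
    (h : IsUnfolding P C P') {q : GroundClause ar U} (hq : q ∈ groundings U P) :
    q ∈ groundings U P' ∨ q ∈ C.ground U := by
  obtain ⟨-, A, G, R, -, -, rfl⟩ := h
  obtain ⟨E, hE, hq⟩ := hq
  by_cases hEC : E = C
  · exact Or.inr (hEC ▸ hq)
  · exact Or.inl ⟨E, Or.inl ⟨hE, hEC⟩, hq⟩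

/-- Some atom of a ground instance of the unfolded clause may be resolved with any ground instance
of the program. -/
theorem IsUnfolding.resolve_mem_groundings [L.Structure U] {P P' : Set (Clause L ar)}
    {C : Clause L ar} (h : IsUnfolding P C P') {q : GroundClause ar U} (hq : q ∈ C.ground U) :
    ∃ g B₂, q.2 = g ::ₘ B₂ ∧
      ∀ B₁, (some g, B₁) ∈ groundings U P → (q.1, B₁ + B₂) ∈ groundings U P' := by
  obtain ⟨-, A, G, R, hC, hR, rfl⟩ := h
  obtain ⟨s, hs, rfl⟩ := hq
  refine ⟨A.ground s, ↑(G.map (Atom.ground s)), ?_, ?_⟩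
  · rw [Multiset.coe_eq_coe.2 (hC.map (Atom.ground s)), List.map_cons, Multiset.cons_coe]
  · rintro B₁ ⟨E, hE, hB⟩
    have hEA : E.HeadPred A.pred := headPred_of_mem_ground hB
    refine ⟨R E, Or.inr ⟨E, ⟨hE, hEA⟩, rfl⟩, ?_⟩
    rw [(hR E hE hEA).ground_eq hC]
    exact ⟨s, B₁, hs, hB, rfl⟩

theorem IsUnfolding.groundTrue [L.Structure U] {P P' : Set (Clause L ar)} {C : Clause L ar}
    (h : IsUnfolding P C P') {I : Interp ar U} (hI : ∀ q ∈ groundings U P, GroundTrue I q) :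
    ∀ q ∈ groundings U P', GroundTrue I q := by
  obtain ⟨hCP, A, G, R, hC, hR, rfl⟩ := h
  rintro q ⟨E', ⟨hE', -⟩ | ⟨E, ⟨hE, hEA⟩, rfl⟩, hq⟩
  · exact hI q ⟨E', hE', hq⟩
  rw [(hR E hE hEA).ground_eq hC] at hq
  obtain ⟨s, B, hs, hB, rfl⟩ := hq
  intro hbody
  refine hI (_, ↑(C.body.map (Atom.ground s))) ⟨C, hCP, s, hs, rfl⟩ fun g hg => ?_
  change g ∈ (↑(C.body.map (Atom.ground s)) : Multiset (GroundAtom ar U)) at hg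
  rw [Multiset.coe_eq_coe.2 (hC.map (Atom.ground s)), List.map_cons, ← Multiset.cons_coe] at hg
  rcases Multiset.mem_cons.1 hg with rfl | hg
  · obtain ⟨g, hg, hgI⟩ := hI _ ⟨E, hE, hB⟩ fun g hg => hbody g (Multiset.mem_add.2 (Or.inl hg))
    cases hg
    exact hgI
  · exact hbody g (Multiset.mem_add.2 (Or.inr hg))

/-- The ground contents of a folding step, which replaces `C` by `E` using the definition `D`: the
instances of `C` are folded into instances of `E`, and conversely an atom in the body of an
instance of `E` may be replaced by the body of any instance of `D` with that head. -/
theorem IsFolding.exists_ground [L.Structure U] {𝒞 : Set (L.Formula ℕ)}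
    {Defs P P' : Set (Clause L ar)} (h : IsFolding U 𝒞 Defs P P') :
    ∃ C ∈ P, ∃ D ∈ Defs, ∃ E : Clause L ar, P' = (P \ {C}) ∪ {E} ∧
      (∀ q ∈ C.ground U, ∃ g B₁ B₂, q.2 = B₁ + B₂ ∧ (some g, B₁) ∈ D.ground U ∧
        (q.1, g ::ₘ B₂) ∈ E.ground U) ∧
      (∀ q ∈ E.ground U, ∃ g B₂, q.2 = g ::ₘ B₂ ∧ D.HeadPred g.1 ∧
        ∀ B₁, (some g, B₁) ∈ D.ground U → (q.1, B₁ + B₂) ∈ C.ground U) := by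
  classical
  obtain ⟨C, hC, D₀, hD₀, ρ, D, K, ϑ, e, X, Y, G, E, hD, hK, -, -, hX, hXb, hc, hz, hYh, hYc,
    hYb, hY, hP'⟩ := h
  refine ⟨C, hC, D₀, hD₀, E, hP', ?_, ?_⟩
  · rw [← hX.ground_eq, ← hY.ground_eq, ← D₀.ground_rename ρ, ← hD]
    rintro _ ⟨s, hs, rfl⟩
    obtain ⟨he, hd⟩ := (hc s).1 hs
    have hd := BoundedFormula.realize_subst.1 hd
    refine ⟨(K.subst ϑ).ground s, ↑((D.body.map (Atom.subst ϑ)).map (TermAtom.ground s)),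
      ↑(G.map (TermAtom.ground s)), ?_, ⟨fun y => (ϑ y).realize s, hd, ?_⟩, s, ?_, ?_⟩
    · rw [Multiset.coe_eq_coe.2 (hXb.map (TermAtom.ground s)), List.map_append, Multiset.coe_add]
    · rw [hK, List.map_map]; rfl
    · rwa [hYc]
    · rw [Multiset.coe_eq_coe.2 (hYb.map (TermAtom.ground s)), hYh, List.map_cons,
        Multiset.cons_coe]
  · rw [← hX.ground_eq, ← hY.ground_eq, ← D₀.ground_rename ρ, ← hD]
    rintro _ ⟨s, hs, rfl⟩
    rw [hYc] at hs
    refine ⟨(K.subst ϑ).ground s, ↑(G.map (TermAtom.ground s)), ?_, ?_, ?_⟩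
    · rw [Multiset.coe_eq_coe.2 (hYb.map (TermAtom.ground s)), List.map_cons, Multiset.cons_coe]
    · have hK' : D₀.head.map (Atom.rename ρ) = some K := by rw [← hK, hD]; rfl
      obtain ⟨K₀, hK₀, rfl⟩ := Option.map_eq_some_iff.1 hK'
      exact ⟨K₀, hK₀, rfl⟩
    · rintro B₁ ⟨t, ht, hq⟩
      rw [hK] at hq
      obtain ⟨hq1, rfl⟩ := Prod.ext_iff.1 hq
      have hq1 : (K.subst ϑ).ground s = K.ground t := Option.some_injective _ hq1
      have hKt : ∀ y ∈ K.vars, (ϑ y).realize s = t y := by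
        rintro _ ⟨i, rfl⟩
        exact congrFun (eq_of_heq (Sigma.mk.inj hq1).2) i
      -- The variables that `ϑ` substitutes for the existential variables of `D` take the values
      -- of these under `t`.
      set V : Set ℕ := formulaVars D.constr ∪ bodyVars D.body with hV
      let s' : ℕ → U := fun z =>
        if h : ∃ y ∈ V \ K.vars, ϑ y = Term.var z then t h.choose else s z
      have hs'_ne : ∀ z, (∀ y ∈ V \ K.vars, ϑ y ≠ Term.var z) → s' z = s z := by
        intro z h
        exact dif_neg (by rintro ⟨y, hy, h'⟩; exact h y hy h')
      have hs'_eq : ∀ y ∈ V \ K.vars, ∀ z, ϑ y = Term.var z → s' z = t y := by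
        intro y hy z hyz
        have hex : ∃ y ∈ V \ K.vars, ϑ y = Term.var z := ⟨y, hy, hyz⟩
        have hch := hex.choose_spec
        have : hex.choose = y := by
          by_contra hne
          obtain ⟨z', hz', -, hzz⟩ := hz y hy
          obtain rfl : z = z' := by
            rw [hyz] at hz'; exact Term.var.inj hz'
          apply hzz _ hch.1.1 hne
          rw [hch.2]
          simp [termVars, Term.varFinset]
        change dite _ _ _ = _
        rw [dif_pos hex, this]
      have hfresh : ∀ z ∈ headVars X.head ∪ formulaVars e ∪ termBodyVars G, s' z = s z := by
        intro z hz₁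
        refine hs'_ne z fun y hy hyz => ?_
        obtain ⟨z', hz', hz₂, -⟩ := hz y hy
        rw [hyz] at hz'
        exact hz₂ (Term.var.inj hz' ▸ hz₁)
      have hval : ∀ y ∈ V, (ϑ y).realize s' = t y := by
        intro y hy
        by_cases hyK : y ∈ K.vars
        · rw [← hKt y hyK]
          refine term_realize_congr fun z hzy => hs'_ne z fun y' hy' hyz => ?_
          obtain ⟨z', hz', -, hz₂⟩ := hz y' hy'
          rw [hyz] at hz'
          obtain rfl := Term.var.inj hz'
          exact hz₂ y hy (fun h => hy'.2 (h ▸ hyK)) hzy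
        · obtain ⟨z, hyz, -⟩ := hz y ⟨hy, hyK⟩
          rw [hyz]
          exact hs'_eq y ⟨hy, hyK⟩ z hyz
      refine ⟨s', (hc s').2 ⟨?_, ?_⟩, ?_⟩
      · exact (realize_congr fun z hz => hfresh z (Or.inl (Or.inr hz))).2 hs
      · refine BoundedFormula.realize_subst.2 ?_
        exact (realize_congr (c := D.constr) fun y hy => hval y (Or.inl hy)).2 ht
      · rw [hYh, Multiset.coe_eq_coe.2 (hXb.map (TermAtom.ground s')), List.map_append,
          termBody_ground_congr (G := G) (fun z hz => hfresh z (Or.inr hz)),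
          head_ground_congr (H := X.head) (fun z hz => hfresh z (Or.inl (Or.inl hz))),
          ← body_ground_congr (G := D.body) (fun y hy => hval y (Or.inr hy)), List.map_map,
          Multiset.coe_add]
        rfl

theorem IsFolding.groundTrue [L.Structure U] {𝒞 : Set (L.Formula ℕ)}
    {Defs P P' : Set (Clause L ar)} (h : IsFolding U 𝒞 Defs P P') {I : Interp ar U}
    (hDefs : ∀ D ∈ Defs, ∀ g : GroundAtom ar U, D.HeadPred g.1 → I g.1 g.2 →
      ∃ B, (some g, B) ∈ D.ground U ∧ ∀ b ∈ B, I b.1 b.2)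
    (hI : ∀ q ∈ groundings U P, GroundTrue I q) : ∀ q ∈ groundings U P', GroundTrue I q := by
  obtain ⟨C, hC, D, hD, E, rfl, -, hE⟩ := h.exists_ground
  rintro q ⟨E', ⟨hE', -⟩ | rfl, hq⟩ hbody
  · exact hI q ⟨E', hE', hq⟩ hbody
  · obtain ⟨g, B₂, hB, hDg, hgC⟩ := hE q hq
    rw [hB] at hbody
    obtain ⟨B₁, hB₁, hB₁I⟩ := hDefs D hD g hDg (hbody g (Multiset.mem_cons_self _ _))
    refine hI (q.1, B₁ + B₂) ⟨C, hC, hgC B₁ hB₁⟩ fun b hb => ?_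
    rcases Multiset.mem_add.1 hb with hb | hb
    · exact hB₁I b hb
    · exact hbody b (Multiset.mem_cons_of_mem hb)

theorem exists_mem_ground_of_existsDisj [L.Structure U] {H : Option (Atom ar)}
    {G : List (Atom ar)} {cs ds : List (L.Formula ℕ)}
    (h : ∀ s : ℕ → U, ExistsDisj (headVars H ∪ bodyVars G) cs s →
      ExistsDisj (headVars H ∪ bodyVars G) ds s)
    {c : L.Formula ℕ} (hc : c ∈ cs) {q : GroundClause ar U}
    (hq : q ∈ (⟨H, c, G⟩ : Clause L ar).ground U) :
    ∃ d ∈ ds, q ∈ (⟨H, d, G⟩ : Clause L ar).ground U := by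
  obtain ⟨s, hs, rfl⟩ := hq
  obtain ⟨s', hs', d, hd, hds⟩ := h s ⟨s, fun _ _ => rfl, c, hc, hs⟩
  have hag : ∀ y ∈ headVars H ∪ bodyVars G, s y = s' y :=
    fun y hy => (hs' y fun hy' => hy'.2 hy).symm
  refine ⟨d, hd, s', hds, ?_⟩
  rw [head_ground_congr fun y hy => hag y (Or.inl hy),
    body_ground_congr fun y hy => hag y (Or.inr hy)]

theorem IsConstraintReplacement.groundings_eq [L.Structure U] {P P' : Set (Clause L ar)}
    (h : IsConstraintReplacement U P P') : groundings U P' = groundings U P := by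
  obtain ⟨H, G, cs, ds, hcs, heq, rfl⟩ := h
  ext q
  constructor
  · rintro ⟨E, ⟨hE, -⟩ | ⟨d, hd, rfl⟩, hq⟩
    · exact ⟨E, hE, hq⟩
    · obtain ⟨c, hc, hq⟩ := exists_mem_ground_of_existsDisj (fun s => (heq s).2) hd hq
      exact ⟨_, hcs ⟨c, hc, rfl⟩, hq⟩
  · rintro ⟨E, hE, hq⟩
    by_cases hEc : ∃ c ∈ cs, E = ⟨H, c, G⟩
    · obtain ⟨c, hc, rfl⟩ := hEc
      obtain ⟨d, hd, hq⟩ := exists_mem_ground_of_existsDisj (fun s => (heq s).1) hc hq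
      exact ⟨_, Or.inr ⟨d, hd, rfl⟩, hq⟩
    · exact ⟨E, Or.inl ⟨hE, hEc⟩, hq⟩

end Ground

section Weight

variable {L : FirstOrder.Language.{u, v}} {Pred : Type x} {ar : Pred → ℕ} {U : Type w}
  [L.Structure U]

/-! ### The weight of a ground atom -/

/-- The possible weights of `g`, if the other atoms have the weights `w`: the total weight of the
body of a ground clause with head `g`, plus one if the clause comes from the program `P₀` and not
from the set `Δ` of definitions. -/
def candidateWeights (P₀ Δ : Set (Clause L ar)) (w : GroundAtom ar U → ℕ∞)
    (g : GroundAtom ar U) : Set ℕ∞ :=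
  {v | ∃ B, ((some g, B) ∈ groundings U P₀ ∧ v = (B.map w).sum + 1) ∨
    ((some g, B) ∈ groundings U Δ ∧ v = (B.map w).sum)}

/-- `w` assigns to each ground atom the least weight of a proof from `P₀ ∪ Δ`, where a use of a
clause of `P₀` weighs one and a use of a clause of `Δ` nothing; `⊤` means that there is no proof. -/
def IsWeight (P₀ Δ : Set (Clause L ar)) (w : GroundAtom ar U → ℕ∞) : Prop :=
  ∀ g, w g = sInf (candidateWeights P₀ Δ w g)

theorem exists_isWeight (P₀ Δ : Set (Clause L ar)) :
    ∃ w : GroundAtom ar U → ℕ∞, IsWeight P₀ Δ w := by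
  let T : (GroundAtom ar U → ℕ∞) →o (GroundAtom ar U → ℕ∞) :=
    { toFun := fun w g => sInf (candidateWeights P₀ Δ w g)
      monotone' := by
        intro w w' hw g
        have hsum : ∀ B : Multiset (GroundAtom ar U), (B.map w).sum ≤ (B.map w').sum :=
          fun B => Multiset.sum_map_le_sum_map _ _ fun b _ => hw b
        refine le_sInf ?_
        rintro v ⟨B, ⟨hB, rfl⟩ | ⟨hB, rfl⟩⟩
        · exact sInf_le_of_le (b := (B.map w).sum + 1) ⟨B, Or.inl ⟨hB, rfl⟩⟩
            (add_le_add_left (hsum B) 1)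
        · exact sInf_le_of_le (b := (B.map w).sum) ⟨B, Or.inr ⟨hB, rfl⟩⟩ (hsum B) }
  exact ⟨T.lfp, fun g => congrFun T.map_lfp.symm g⟩

namespace IsWeight

variable {P₀ Δ : Set (Clause L ar)} {w : GroundAtom ar U → ℕ∞}

theorem le_of_mem_program (hw : IsWeight P₀ Δ w) {g : GroundAtom ar U}
    {B : Multiset (GroundAtom ar U)} (hB : (some g, B) ∈ groundings U P₀) :
    w g ≤ (B.map w).sum + 1 := by
  rw [hw g]
  exact sInf_le ⟨B, Or.inl ⟨hB, rfl⟩⟩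

theorem le_of_mem_definitions (hw : IsWeight P₀ Δ w) {g : GroundAtom ar U}
    {B : Multiset (GroundAtom ar U)} (hB : (some g, B) ∈ groundings U Δ) :
    w g ≤ (B.map w).sum := by
  rw [hw g]
  exact sInf_le ⟨B, Or.inr ⟨hB, rfl⟩⟩

theorem exists_eq (hw : IsWeight P₀ Δ w) {g : GroundAtom ar U} (hg : w g ≠ ⊤) :
    ∃ B, ((some g, B) ∈ groundings U P₀ ∧ w g = (B.map w).sum + 1) ∨
      ((some g, B) ∈ groundings U Δ ∧ w g = (B.map w).sum) := by
  have hne : (candidateWeights P₀ Δ w g).Nonempty := by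
    by_contra h
    rw [Set.not_nonempty_iff_eq_empty] at h
    rw [hw g, h, sInf_empty] at hg
    exact hg rfl
  have := csInf_mem hne
  rwa [← hw g] at this

end IsWeight

/-! ### Covered heads -/

/-- The head `h` (`none` stands for `false`) is covered by `P` within the weight `b`: some ground
instance of a clause of `P` has the head `h` and a body of weight at most `b`. -/
def Covers (w : GroundAtom ar U → ℕ∞) (P : Set (Clause L ar)) (h : Option (GroundAtom ar U))
    (b : ℕ∞) : Prop :=
  ∃ B, (h, B) ∈ groundings U P ∧ (B.map w).sum ≤ b

/-- Every provable ground atom with the predicate `p` is covered within its own weight. -/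
def WeaklyCovers (w : GroundAtom ar U → ℕ∞) (P : Set (Clause L ar)) (p : Pred) : Prop :=
  ∀ g : GroundAtom ar U, g.1 = p → w g ≠ ⊤ → Covers w P (some g) (w g)

/-- Every provable ground atom with the predicate `p` is covered within a smaller weight. -/
def StrictlyCovers (w : GroundAtom ar U → ℕ∞) (P : Set (Clause L ar)) (p : Pred) : Prop :=
  ∀ g : GroundAtom ar U, g.1 = p → w g ≠ ⊤ → ∃ b, b + 1 ≤ w g ∧ Covers w P (some g) b

variable {w : GroundAtom ar U → ℕ∞}

theorem StrictlyCovers.weaklyCovers {P : Set (Clause L ar)} {p : Pred}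
    (h : StrictlyCovers w P p) : WeaklyCovers w P p := by
  intro g hg hw
  obtain ⟨b, hb, B, hB, hBb⟩ := h g hg hw
  exact ⟨B, hB, hBb.trans (le_self_add.trans hb)⟩

theorem IsUnfolding.covers {P P' : Set (Clause L ar)} {C : Clause L ar}
    (h : IsUnfolding P C P') (hP : ∀ A ∈ C.body, WeaklyCovers w P A.pred)
    {q : Option (GroundAtom ar U)} {b : ℕ∞} (hb : b ≠ ⊤) (hq : Covers w P q b) :
    Covers w P' q b := by
  obtain ⟨B, hB, hBb⟩ := hq
  rcases h.mem_groundings hB with hB' | hB'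
  · exact ⟨B, hB', hBb⟩
  obtain ⟨g, B₂, hBg, hres⟩ := h.resolve_mem_groundings hB'
  obtain rfl : B = g ::ₘ B₂ := hBg
  obtain ⟨A, hA, hAg⟩ := exists_body_pred_of_mem_ground hB' (Multiset.mem_cons_self g B₂)
  rw [Multiset.map_cons, Multiset.sum_cons] at hBb
  have hg : w g ≠ ⊤ := ne_top_of_le_ne_top hb (le_self_add.trans hBb)
  obtain ⟨B₁, hB₁, hle⟩ := hP A hA g hAg.symm hg
  refine ⟨_, hres B₁ hB₁, ?_⟩
  rw [Multiset.map_add, Multiset.sum_add]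
  exact (add_le_add_left hle _).trans hBb

/-- Unfolding an instance of `C` whose atoms are strictly covered makes its body lighter. -/
theorem IsUnfolding.covers_strictly {P P' : Set (Clause L ar)} {C : Clause L ar}
    (h : IsUnfolding P C P') (hP : ∀ A ∈ C.body, StrictlyCovers w P A.pred)
    {q : GroundClause ar U} (hq : q ∈ C.ground U) (hw : (q.2.map w).sum ≠ ⊤) :
    ∃ b, b + 1 ≤ (q.2.map w).sum ∧ Covers w P' q.1 b := by
  obtain ⟨g, B₂, hBg, hres⟩ := h.resolve_mem_groundings hq
  obtain ⟨A, hA, hAg⟩ := exists_body_pred_of_mem_ground hq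
    (hBg ▸ Multiset.mem_cons_self g B₂ : g ∈ q.2)
  rw [hBg, Multiset.map_cons, Multiset.sum_cons] at hw ⊢
  have hg : w g ≠ ⊤ := ne_top_of_le_ne_top hw le_self_add
  obtain ⟨b, hb, B₁, hB₁, hle⟩ := hP A hA g hAg.symm hg
  refine ⟨b + (B₂.map w).sum, ?_, _, hres B₁ hB₁, ?_⟩
  · rw [add_right_comm]
    exact add_le_add_left hb _
  · rw [Multiset.map_add, Multiset.sum_add]
    exact add_le_add_left hle _

/-- An instance of the body of a definition weighs at least as much as the head that replaces
it. -/
theorem IsFolding.covers {P₀ Δ : Set (Clause L ar)} (hw : IsWeight P₀ Δ w)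
    {𝒞 : Set (L.Formula ℕ)} {Defs P P' : Set (Clause L ar)} (h : IsFolding U 𝒞 Defs P P')
    (hDefs : Defs ⊆ Δ) {q : Option (GroundAtom ar U)} {b : ℕ∞} (hq : Covers w P q b) :
    Covers w P' q b := by
  obtain ⟨C, hC, D, hD, E, rfl, hCE, -⟩ := h.exists_ground
  obtain ⟨B, ⟨C', hC', hB⟩, hBb⟩ := hq
  by_cases hCC : C' = C
  · subst hCC
    obtain ⟨g, B₁, B₂, hBe, hDg, hE⟩ := hCE _ hB
    obtain rfl : B = B₁ + B₂ := hBe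
    refine ⟨g ::ₘ B₂, ⟨E, Or.inr rfl, hE⟩, le_trans ?_ hBb⟩
    rw [Multiset.map_cons, Multiset.sum_cons, Multiset.map_add, Multiset.sum_add]
    exact add_le_add_left (hw.le_of_mem_definitions ⟨D, hDefs hD, hDg⟩) _
  · exact ⟨B, ⟨C', Or.inl ⟨hC', hCC⟩, hB⟩, hBb⟩

/-- The provable ground atoms are true in every model of a program that covers them strictly. -/
theorem holds_of_strictlyCovers {P : Set (Clause L ar)} (hP : ∀ p, StrictlyCovers w P p)
    {I : Interp ar U} (hI : ∀ q ∈ groundings U P, GroundTrue I q) (g : GroundAtom ar U)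
    (hg : w g ≠ ⊤) : I g.1 g.2 := by
  induction hn : w g using WellFoundedLT.induction generalizing g with
  | ind n ih =>
    obtain ⟨b, hb, B, hB, hBb⟩ := hP g.1 g rfl hg
    have hbt : b ≠ ⊤ := ne_top_of_le_ne_top hg (le_self_add.trans hb)
    have hlt : b < w g := (ENat.add_one_le_iff hbt).1 hb
    obtain ⟨_, hg', h⟩ := hI _ hB fun g' hg' => by
      have hle : w g' ≤ b :=
        (Multiset.le_sum_of_mem (Multiset.mem_map_of_mem w hg')).trans hBb
      exact ih (w g') (hn ▸ hle.trans_lt hlt) g' (ne_top_of_le_ne_top hbt hle) rfl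
    cases hg'
    exact h

end Weight

/-! ### Definitions in a transformation sequence -/

namespace IsTransformationSequence

variable {L : FirstOrder.Language.{u, v}} {Pred : Type x} {ar : Pred → ℕ} {U : Type w}
  [L.Structure U] {𝒞 𝒜 : Set (L.Formula ℕ)} {n : ℕ} {P Defs : ℕ → Set (Clause L ar)}

theorem defs_subset_succ (hP : IsTransformationSequence U 𝒞 𝒜 n P Defs) {i : ℕ} (hi : i < n) :
    Defs i ⊆ Defs (i + 1) := by
  rcases hP.step i hi with ⟨D, -, -, h⟩ | ⟨h, -⟩
  · rw [h]; exact Set.subset_union_left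
  · rw [h]

theorem defs_subset (hP : IsTransformationSequence U 𝒞 𝒜 n P Defs) {i j : ℕ} (hij : i ≤ j)
    (hj : j ≤ n) : Defs i ⊆ Defs j := by
  induction j, hij using Nat.le_induction with
  | base => exact subset_rfl
  | succ j _ ih => exact (ih (by omega)).trans (hP.defs_subset_succ (by omega))

theorem exists_introduced (hP : IsTransformationSequence U 𝒞 𝒜 n P Defs) {i : ℕ} (hi : i ≤ n)
    {D : Clause L ar} (hD : D ∈ Defs i) :
    ∃ j < i, D ∉ Defs j ∧ IsNewDefinition 𝒜 P j D ∧ P (j + 1) = P j ∪ {D} ∧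
      Defs (j + 1) = Defs j ∪ {D} := by
  induction i with
  | zero => rw [hP.defs_zero] at hD; exact hD.elim
  | succ i ih =>
    by_cases hDi : D ∈ Defs i
    · obtain ⟨j, hj, h⟩ := ih (by omega) hDi
      exact ⟨j, by omega, h⟩
    · rcases hP.step i hi with ⟨D', hnew, hPi, hDe⟩ | ⟨h, -⟩
      · rw [hDe] at hD
        obtain rfl : D = D' := hD.resolve_left hDi
        exact ⟨i, by omega, hDi, hnew, hPi, hDe⟩
      · exact absurd (h ▸ hD) hDi

theorem not_occurs_of_headPred {i : ℕ} {D : Clause L ar} (hD : IsNewDefinition 𝒜 P i D) {p : Pred}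
    (hp : D.HeadPred p) {j : ℕ} (hj : j ≤ i) : ¬ Occurs p (P j) := by
  obtain ⟨K, hK, hnew, -⟩ := hD
  obtain ⟨K', hK', rfl⟩ := hp
  rw [hK] at hK'
  cases hK'
  exact hnew j hj

/-- The head predicate of a definition that is not introduced before the stage `i` does not occur
in `P i`. -/
theorem mem_defs_of_occurs (hP : IsTransformationSequence U 𝒞 𝒜 n P Defs) {i : ℕ} (hi : i ≤ n)
    {p : Pred} (hp : Occurs p (P i)) {D : Clause L ar} (hD : D ∈ Defs n) (hDp : D.HeadPred p) :
    D ∈ Defs i := by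
  obtain ⟨j, hj, -, hnew, -, hDe⟩ := hP.exists_introduced le_rfl hD
  rcases lt_or_ge j i with hji | hij
  · exact hP.defs_subset hji hi (hDe ▸ Or.inr rfl)
  · exact absurd hp (not_occurs_of_headPred hnew hDp hij)

theorem not_headPred_of_occurs_zero (hP : IsTransformationSequence U 𝒞 𝒜 n P Defs)
    {p : Pred} (hp : Occurs p (P 0)) {D : Clause L ar} (hD : D ∈ Defs n) : ¬ D.HeadPred p := by
  intro hDp
  have := hP.mem_defs_of_occurs (Nat.zero_le n) hp hD hDp
  rw [hP.defs_zero] at this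
  exact this

theorem occurs_body (hP : IsTransformationSequence U 𝒞 𝒜 n P Defs) {D : Clause L ar}
    (hD : D ∈ Defs n) {A : Atom ar} (hA : A ∈ D.body) : Occurs A.pred (P 0) := by
  obtain ⟨j, -, -, ⟨K, -, -, -, -, h, -⟩, -⟩ := hP.exists_introduced le_rfl hD
  exact h A hA

theorem eq_of_headPred (hP : IsTransformationSequence U 𝒞 𝒜 n P Defs) {D D' : Clause L ar}
    (hD : D ∈ Defs n) (hD' : D' ∈ Defs n) {p : Pred} (hp : D.HeadPred p) (hp' : D'.HeadPred p) :
    D = D' := by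
  obtain ⟨j, hj, hDj, hnew, hPj, hDe⟩ := hP.exists_introduced le_rfl hD
  obtain ⟨j', hj', hDj', hnew', hPj', hDe'⟩ := hP.exists_introduced le_rfl hD'
  have hocc : Occurs p (P (j + 1)) := ⟨D, hPj ▸ Or.inr rfl, Or.inl hp⟩
  have hocc' : Occurs p (P (j' + 1)) := ⟨D', hPj' ▸ Or.inr rfl, Or.inl hp'⟩
  rcases lt_trichotomy j j' with h | rfl | h
  · exact absurd hocc (not_occurs_of_headPred hnew' hp' h)
  · have : D' ∈ Defs j ∪ {D} := hDe ▸ hDe' ▸ Or.inr rfl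
    exact (this.resolve_left hDj').symm
  · exact absurd hocc' (not_occurs_of_headPred hnew hp h)

/-! ### Every model of the program extends to the transformed programs -/

/-- The extension of `I` that gives the head predicates of the definitions in `Δ`
their defined meaning. -/
def extension (I : Interp ar U) (Δ : Set (Clause L ar)) : Interp ar U := fun p a =>
  ((∀ D ∈ Δ, ¬ D.HeadPred p) ∧ I p a) ∨
    ∃ B : Multiset (GroundAtom ar U), (some ⟨p, a⟩, B) ∈ groundings U Δ ∧ ∀ b ∈ B, I b.1 b.2

theorem extension_iff_of_occurs (hP : IsTransformationSequence U 𝒞 𝒜 n P Defs)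
    (I : Interp ar U) {g : GroundAtom ar U} (hg : Occurs g.1 (P 0)) :
    extension I (Defs n) g.1 g.2 ↔ I g.1 g.2 := by
  constructor
  · rintro (⟨-, h⟩ | ⟨B, ⟨D, hD, hB⟩, -⟩)
    · exact h
    · exact absurd (headPred_of_mem_ground hB) (hP.not_headPred_of_occurs_zero hg hD)
  · exact fun h => Or.inl ⟨fun D hD => hP.not_headPred_of_occurs_zero hg hD, h⟩

theorem occurs_of_mem_body (hP : IsTransformationSequence U 𝒞 𝒜 n P Defs) {D : Clause L ar}
    (hD : D ∈ Defs n) {q : GroundClause ar U} (hq : q ∈ D.ground U) {g : GroundAtom ar U}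
    (hg : g ∈ q.2) : Occurs g.1 (P 0) := by
  obtain ⟨A, hA, hAg⟩ := exists_body_pred_of_mem_ground hq hg
  exact hAg ▸ hP.occurs_body hD hA

theorem groundTrue_extension (hP : IsTransformationSequence U 𝒞 𝒜 n P Defs) {I : Interp ar U}
    (hI : ∀ q ∈ groundings U (P 0), GroundTrue I q) {i : ℕ} (hi : i ≤ n) :
    ∀ q ∈ groundings U (P i), GroundTrue (extension I (Defs n)) q := by
  induction i with
  | zero =>
    rintro q ⟨C, hC, hq⟩ hbody
    obtain ⟨g, hg, hgI⟩ := hI q ⟨C, hC, hq⟩ fun g hg => by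
      obtain ⟨A, hA, hAg⟩ := exists_body_pred_of_mem_ground hq hg
      exact (hP.extension_iff_of_occurs I ⟨C, hC, Or.inr ⟨A, hA, hAg⟩⟩).1 (hbody g hg)
    obtain ⟨_, B⟩ := q
    cases hg
    exact ⟨g, rfl, (hP.extension_iff_of_occurs I
      ⟨C, hC, Or.inl (headPred_of_mem_ground hq)⟩).2 hgI⟩
  | succ i ih =>
    specialize ih (by omega)
    rcases hP.step i hi with ⟨D, hnew, hPi, hDe⟩ | ⟨-, ⟨C, h⟩ | h | h⟩
    · rw [hPi]
      rintro q ⟨C, hC | rfl, hq⟩ hbody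
      · exact ih q ⟨C, hC, hq⟩ hbody
      · have hD : C ∈ Defs n := hP.defs_subset hi le_rfl (hDe ▸ Or.inr rfl)
        obtain ⟨K, hK, -⟩ := hnew
        have hq' := hq
        obtain ⟨s, -, rfl⟩ := hq
        refine ⟨K.ground s, by simp [hK], Or.inr ⟨_, ⟨C, hD, ?_⟩, fun b hb =>
          (hP.extension_iff_of_occurs I (hP.occurs_of_mem_body hD hq' hb)).1 (hbody b hb)⟩⟩
        rw [hK] at hq'
        exact hq'
    · exact h.groundTrue ih
    · refine h.groundTrue (fun D hD g hDg hg => ?_) ih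
      have hDn : D ∈ Defs n := hP.defs_subset (by omega) le_rfl hD
      rcases hg with ⟨hg, -⟩ | ⟨B, ⟨D', hD', hB⟩, hBI⟩
      · exact absurd hDg (hg D hDn)
      · obtain rfl := hP.eq_of_headPred hDn hD' hDg (headPred_of_mem_ground hB)
        exact ⟨B, hB, fun b hb =>
          (hP.extension_iff_of_occurs I (hP.occurs_of_mem_body hDn hB hb)).2 (hBI b hb)⟩
    · rw [h.groundings_eq]
      exact ih

/-! ### Covered heads stay covered -/

variable {w : GroundAtom ar U → ℕ∞}

theorem strictlyCovers_zero (hw : IsWeight (P 0) (Defs n) w) {p : Pred}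
    (hp : ∀ D ∈ Defs n, ¬ D.HeadPred p) : StrictlyCovers w (P 0) p := by
  rintro g rfl hg
  obtain ⟨B, ⟨hB, h⟩ | ⟨⟨D, hD, hB⟩, -⟩⟩ := hw.exists_eq hg
  · exact ⟨_, h.ge, B, hB, le_rfl⟩
  · exact absurd (headPred_of_mem_ground hB) (hp D hD)

/-- The only clause that proves an instance of the head of a definition is the definition. -/
theorem exists_mem_ground_of_headPred (hP : IsTransformationSequence U 𝒞 𝒜 n P Defs)
    (hw : IsWeight (P 0) (Defs n) w) {D : Clause L ar} (hD : D ∈ Defs n) {g : GroundAtom ar U}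
    (hDg : D.HeadPred g.1) (hg : w g ≠ ⊤) :
    ∃ B, (some g, B) ∈ D.ground U ∧ w g = (B.map w).sum := by
  obtain ⟨B, ⟨⟨C, hC, hB⟩, -⟩ | ⟨⟨D', hD', hB⟩, h⟩⟩ := hw.exists_eq hg
  · exact absurd hDg (hP.not_headPred_of_occurs_zero
      ⟨C, hC, Or.inl (headPred_of_mem_ground hB)⟩ hD)
  · obtain rfl := hP.eq_of_headPred hD hD' hDg (headPred_of_mem_ground hB)
    exact ⟨B, hB, h⟩

/-- One step of the sequence preserves coverage, provided that the predicates that occur are weakly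
covered. -/
theorem covers_succ (hP : IsTransformationSequence U 𝒞 𝒜 n P Defs)
    (hw : IsWeight (P 0) (Defs n) w) {i : ℕ} (hi : i < n)
    (hcov : ∀ p, Occurs p (P i) → WeaklyCovers w (P i) p)
    {q : Option (GroundAtom ar U)} {b : ℕ∞} (hb : b ≠ ⊤) (hq : Covers w (P i) q b) :
    Covers w (P (i + 1)) q b := by
  rcases hP.step i hi with ⟨D, -, hPi, -⟩ | ⟨-, ⟨C, h⟩ | h | h⟩
  · obtain ⟨B, hB, hBb⟩ := hq
    exact ⟨B, groundings_mono (hPi ▸ Set.subset_union_left) hB, hBb⟩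
  · exact h.covers (fun A hA => hcov _ ⟨C, h.1, Or.inr ⟨A, hA, rfl⟩⟩) hb hq
  · exact h.covers hw (hP.defs_subset hi.le le_rfl) hq
  · obtain ⟨B, hB, hBb⟩ := hq
    exact ⟨B, h.groundings_eq ▸ hB, hBb⟩

theorem weaklyCovers (hP : IsTransformationSequence U 𝒞 𝒜 n P Defs)
    (hw : IsWeight (P 0) (Defs n) w) {i : ℕ} (hi : i ≤ n) {p : Pred}
    (hp : ∀ D ∈ Defs n, D.HeadPred p → D ∈ Defs i) : WeaklyCovers w (P i) p := by
  induction i generalizing p with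
  | zero =>
    refine (strictlyCovers_zero hw fun D hD hDp => ?_).weaklyCovers
    have := hp D hD hDp
    rw [hP.defs_zero] at this
    exact this
  | succ i ih =>
    rintro g rfl hg
    by_cases hpi : ∀ D ∈ Defs n, D.HeadPred g.1 → D ∈ Defs i
    · exact hP.covers_succ hw hi
        (fun p hp => ih (by omega) fun D hD => hP.mem_defs_of_occurs (by omega) hp hD) hg
        (ih (by omega) hpi g rfl hg)
    · push Not at hpi
      obtain ⟨D, hD, hDg, hDi⟩ := hpi
      rcases hP.step i hi with ⟨D', -, hPi, hDe⟩ | ⟨hDe, -⟩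
      · obtain rfl : D = D' := by
          have := hp D hD hDg
          rw [hDe] at this
          exact this.resolve_left hDi
        obtain ⟨B, hB, h⟩ := hP.exists_mem_ground_of_headPred hw hD hDg hg
        exact ⟨B, ⟨D, hPi ▸ Or.inr rfl, hB⟩, h.ge⟩
      · exact absurd (hDe ▸ hp D hD hDg) hDi

theorem weaklyCovers_of_occurs (hP : IsTransformationSequence U 𝒞 𝒜 n P Defs)
    (hw : IsWeight (P 0) (Defs n) w) {i : ℕ} (hi : i ≤ n) {p : Pred} (hp : Occurs p (P i)) :
    WeaklyCovers w (P i) p :=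
  hP.weaklyCovers hw hi fun _ hD => hP.mem_defs_of_occurs hi hp hD

theorem covers_of_le (hP : IsTransformationSequence U 𝒞 𝒜 n P Defs)
    (hw : IsWeight (P 0) (Defs n) w) {i j : ℕ} (hij : i ≤ j) (hj : j ≤ n)
    {q : Option (GroundAtom ar U)} {b : ℕ∞} (hb : b ≠ ⊤) (hq : Covers w (P i) q b) :
    Covers w (P j) q b := by
  induction j, hij using Nat.le_induction with
  | base => exact hq
  | succ j _ ih =>
    exact hP.covers_succ hw hj (fun p => hP.weaklyCovers_of_occurs hw (by omega)) hb
      (ih (by omega))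

theorem strictlyCovers_of_le (hP : IsTransformationSequence U 𝒞 𝒜 n P Defs)
    (hw : IsWeight (P 0) (Defs n) w) {i j : ℕ} (hij : i ≤ j) (hj : j ≤ n) {p : Pred}
    (hp : StrictlyCovers w (P i) p) : StrictlyCovers w (P j) p := by
  intro g hgp hg
  obtain ⟨b, hb, hq⟩ := hp g hgp hg
  exact ⟨b, hb, hP.covers_of_le hw hij hj
    (ne_top_of_le_ne_top hg (le_self_add.trans hb)) hq⟩

/-- Unfolding a definition makes the coverage of its head strict, because the predicates of its
body occur in the initial program and thus are strictly covered all along. -/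
theorem strictlyCovers_last (hP : IsTransformationSequence U 𝒞 𝒜 n P Defs)
    (hw : IsWeight (P 0) (Defs n) w)
    (hunf : ∀ D ∈ Defs n, ∃ i < n, IsUnfolding (P i) D (P (i + 1))) (p : Pred) :
    StrictlyCovers w (P n) p := by
  by_cases hp : ∃ D ∈ Defs n, D.HeadPred p
  · obtain ⟨D, hD, hDp⟩ := hp
    obtain ⟨i, hi, hu⟩ := hunf D hD
    refine hP.strictlyCovers_of_le hw hi le_rfl ?_
    rintro g rfl hg
    obtain ⟨B, hB, h⟩ := hP.exists_mem_ground_of_headPred hw hD hDp hg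
    rw [h] at hg ⊢
    exact hu.covers_strictly (fun A hA => hP.strictlyCovers_of_le hw (Nat.zero_le i) hi.le
      (strictlyCovers_zero hw fun D' hD' =>
        hP.not_headPred_of_occurs_zero (hP.occurs_body hD hA) hD')) hB hg
  · push Not at hp
    exact hP.strictlyCovers_of_le hw (Nat.zero_le n) le_rfl (strictlyCovers_zero hw hp)

/-- The provable ground atoms form a model of `P 0`: if an instance of a goal had a provable body,
then `false` would still be covered in `P n`, whose models contain the provable ground atoms. -/
theorem groundTrue_weight (hP : IsTransformationSequence U 𝒞 𝒜 n P Defs)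
    (hw : IsWeight (P 0) (Defs n) w)
    (hunf : ∀ D ∈ Defs n, ∃ i < n, IsUnfolding (P i) D (P (i + 1))) {I : Interp ar U}
    (hI : ∀ q ∈ groundings U (P n), GroundTrue I q) :
    ∀ q ∈ groundings U (P 0), GroundTrue (fun p a => w ⟨p, a⟩ ≠ ⊤) q := by
  rintro ⟨h, B⟩ hq hbody
  have hB : (B.map w).sum ≠ ⊤ := by
    clear hq
    induction B using Multiset.induction with
    | empty => simp
    | cons g B ih =>
      rw [Multiset.map_cons, Multiset.sum_cons]
      exact WithTop.add_ne_top.2 ⟨hbody g (Multiset.mem_cons_self _ _),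
        ih fun g' hg' => hbody g' (Multiset.mem_cons_of_mem hg')⟩
  cases h with
  | some g => exact ⟨g, rfl, ne_top_of_le_ne_top (by simpa using hB) (hw.le_of_mem_program hq)⟩
  | none =>
    obtain ⟨B', hB', hle⟩ := hP.covers_of_le hw (Nat.zero_le n) le_rfl hB ⟨B, hq, le_rfl⟩
    obtain ⟨g, hg, -⟩ := hI _ hB' fun g hg =>
      holds_of_strictlyCovers (hP.strictlyCovers_last hw hunf) hI g
        (ne_top_of_le_ne_top hB
          ((Multiset.le_sum_of_mem (Multiset.mem_map_of_mem w hg)).trans hle))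
    cases hg

end IsTransformationSequence

end CHC

theorem theorem1 {L : FirstOrder.Language.{u, v}} {Pred : Type x} (ar : Pred → ℕ)
    (U : Type w) [Nonempty U] [L.Structure U]
    (𝒞 𝒜 : Set (L.Formula ℕ)) (h𝒞 : CHC.IsConstraintSet 𝒞) (h𝒜 : 𝒜 ⊆ 𝒞)
    (n : ℕ) (P Defs : ℕ → Set (CHC.Clause L ar))
    (hP : CHC.IsTransformationSequence U 𝒞 𝒜 n P Defs)
    (hunf : ∀ D ∈ Defs n, ∃ i < n, CHC.IsUnfolding (P i) D (P (i + 1))) :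
    CHC.DSatisfiable U (P 0) ↔ CHC.DSatisfiable U (P n) := by
  constructor
  · rintro ⟨I, hI⟩
    exact ⟨_, CHC.forall_isTrue_iff.2
      (hP.groundTrue_extension (CHC.forall_isTrue_iff.1 hI) le_rfl)⟩
  · rintro ⟨I, hI⟩
    obtain ⟨w, hw⟩ := CHC.exists_isWeight (U := U) (P 0) (Defs n)
    exact ⟨_, CHC.forall_isTrue_iff.2
      (hP.groundTrue_weight hw hunf (CHC.forall_isTrue_iff.1 hI))⟩
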